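/- Let $T$ and $M$ be smooth manifolds of dimensions $p$ and $n$, with coordinates $(t^\alpha)$ and $(x^i)$, and let $J^1(T,M)$ be the jet space, with coordinates $(t^\alpha,x^i,x^i_\alpha)$. Let $h=(h_{\alpha\beta}(t))$ be a semi-Riemannian metric on $T$ and let $ML^n_p=(J^1(T,M),L)$ be a metrical multi-time Lagrange space: $L:J^1(T,M)\to\mathbb R$ is smooth and $\frac12\frac{\partial^2L}{\partial x^i_\alpha\partial x^j_\beta}=h^{\alpha\beta}(t)\,g_{ij}$ with a symmetric d-tensor $g_{ij}(t,x,x_\gamma)$ of rank $n$ and constant signature. Let $H^\gamma_{\alpha\beta}$ be the Christoffel symbols of $h$, $\Gamma^i_{jk}=\frac{g^{im}}2(\partial_{x^k}g_{mj}+\partial_{x^j}g_{mk}-\partial_{x^m}g_{jk})$, and let the canonical nonlinear connection be $M^{(i)}_{(\alpha)\beta}=-H^\gamma_{\alpha\beta}x^i_\gamma$ and, for $p=1$ (with $t=t^1$, $y^i=x^i_1$), $N^{(i)}_{(1)j}=h_{11}\frac{\partial\mathcal G^i}{\partial y^j}$, $$\mathcal G^i=\frac{g^{ik}}4\Big(\frac{\partial^2L}{\partial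 x^j\partial y^k}y^j-\frac{\partial L}{\partial x^k}+\frac{\partial^2L}{\partial t\,\partial y^k}+\frac{\partial L}{\partial y^k}H^1_{11}+2h^{11}H^1_{11}g_{kl}y^l\Big),$$ while for $p\ge2$, $N^{(i)}_{(\alpha)j}=\Gamma^i_{jk}x^k_\alpha+\frac{g^{ik}}2\frac{\partial g_{jk}}{\partial t^\alpha}+\frac{g^{ik}}4h_{\alpha\beta}\Big(\frac{\partial U^{(\beta)}_{(k)}}{\partial x^j}-\frac{\partial U^{(\beta)}_{(j)}}{\partial x^k}\Big)$ with $U^{(\beta)}_{(k)}(t,x)=\frac{\partial L}{\partial x^k_\beta}\big|_{x^i_\alpha=0}$. Let $(X_A)$ be the adapted basis $$\frac{\delta}{\delta t^\alpha}=\frac{\partial}{\partial t^\alpha}-M^{(j)}_{(\beta)\alpha}\frac{\partial}{\partial x^j_\beta},\qquad \frac{\delta}{\delta x^i}=\frac{\partial}{\partial x^i}-N^{(j)}_{(\beta)i}\frac{\partial}{\partial x^j_\beta},\qquad \frac{\partial}{\partial x^i_\alpha},$$ let $\delta x^i_\alpha=dx^i_\alpha+M^{(i)}_{(\alpha)\beta}dt^\beta+N^{(i)}_{(\alpha)j}dx^j$,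 and $G=h_{\alpha\beta}dt^\alpha\otimes dt^\beta+g_{ij}dx^i\otimes dx^j+h^{\alpha\beta}g_{ij}\,\delta x^i_\alpha\otimes\delta x^j_\beta$. Let $C\Gamma$ be the Cartan canonical connection, i.e. the linear connection with $\nabla_{X_C}\frac{\delta}{\delta t^\alpha}=\Gamma^\gamma_{\alpha C}\frac{\delta}{\delta t^\gamma}$, $\nabla_{X_C}\frac{\delta}{\delta x^j}=\Gamma^k_{jC}\frac{\delta}{\delta x^k}$, $\nabla_{X_C}\frac{\partial}{\partial x^i_\alpha}=(\delta^\alpha_\beta\Gamma^k_{iC}-\delta^k_i\Gamma^\alpha_{\beta C})\frac{\partial}{\partial x^k_\beta}$, where $\Gamma^\gamma_{\alpha C}$ equals $H^\gamma_{\alpha\beta}$ for $X_C=\frac{\delta}{\delta t^\beta}$ and $0$ otherwise, and $\Gamma^k_{jC}$ equals $\frac{g^{ki}}2\frac{\delta g_{ij}}{\delta t^\gamma}$ for $X_C=\frac{\delta}{\delta t^\gamma}$, $\frac{g^{km}}2\big(\frac{\delta g_{mj}}{\delta x^i}+\frac{\delta g_{mi}}{\delta x^j}-\frac{\delta g_{ji}}{\delta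 x^m}\big)$ for $X_C=\frac{\delta}{\delta x^i}$, and $\frac{g^{km}}2\big(\frac{\partial g_{mj}}{\partial x^i_\gamma}+\frac{\partial g_{mi}}{\partial x^j_\gamma}-\frac{\partial g_{ji}}{\partial x^m_\gamma}\big)$ for $X_C=\frac{\partial}{\partial x^i_\gamma}$. Its local covariant derivatives along $\frac{\delta}{\delta t^\gamma}$, $\frac{\delta}{\delta x^k}$, $\frac{\partial}{\partial x^k_\gamma}$ are written ${}_{/\gamma}$, ${}_{|k}$, $|^{(\gamma)}_{(k)}$. Its curvature is $\mathbf R(X_C,X_B)X_A=R^D_{ABC}X_D$, its Ricci d-tensor is $R_{AB}=R^D_{ABD}$, and $Sc=G^{AB}R_{AB}$. The Ricci components are denoted $H_{\alpha\beta}$ (temporal–temporal), $R_{i\alpha}$, $R_{ij}$, $P^{\ (\beta)}_{i(j)}$ (spatial–vertical), $P^{(\alpha)}_{(i)\beta}$, $P^{(\alpha)}_{(i)j}$ (vertical–temporal, vertical–spatial), $S^{(\alpha)(\beta)}_{(i)(j)}$ (vertical–vertical), and $H=h^{\alpha\beta}H_{\alpha\beta}$, $R=g^{ij}R_{ij}$,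 $S=h_{\alpha\beta}g^{ij}S^{(\alpha)(\beta)}_{(i)(j)}$. **Theorem.** Let $\mathcal K\in\mathbb R$ and let the d-tensor $\mathcal T$ satisfy the Einstein equations $R_{AB}-\frac{Sc}2G_{AB}=\mathcal K\mathcal T_{AB}$. Put $\mathcal T^B_A=G^{BD}\mathcal T_{DA}$. In every system of adapted coordinates and at every point, the conservation laws $\mathcal T^B_{A|B}=0$ (for all $A$; here ${}_{|B}$ is the covariant derivative along $X_B$) imply the following formulas, and are equivalent to them if $\mathcal K\ne0$. i) For $p=1$: $$\Big[\frac{R+S}2\Big]_{/1}=R^m_{1|m}+P^{(m)}_{(1)1}\big|^{(1)}_{(m)},\qquad \Big[R^m_j-\frac{R+S}2\delta^m_j\Big]_{|m}=-P^{(m)}_{(1)j}\big|^{(1)}_{(m)},$$ $$\Big[S^{(m)(1)}_{(1)(j)}-\frac{R+S}2\delta^m_j\Big]\Big|^{(1)}_{(m)}=-P^{m(1)}_{\ \ (j)|m},$$ where $R^i_1=g^{im}R_{m1}$, $P^{(i)}_{(1)1}=h_{11}g^{im}P^{(1)}_{(m)1}$, $R^i_j=g^{im}R_{mj}$, $P^{(i)}_{(1)j}=h_{11}g^{im}P^{(1)}_{(m)j}$,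 $P^{i(1)}_{\ \ (j)}=g^{im}P^{\ (1)}_{m(j)}$, $S^{(i)(1)}_{(1)(j)}=h_{11}g^{im}S^{(1)(1)}_{(m)(j)}$. ii) For $p\ge2$: $$\Big[H^\mu_\beta-\frac{H+R}2\delta^\mu_\beta\Big]_{/\mu}=-R^m_{\beta|m},\qquad \Big[R^m_j-\frac{H+R}2\delta^m_j\Big]_{|m}=0,$$ where $H^\mu_\beta=h^{\mu\gamma}H_{\gamma\beta}$, $R^i_j=g^{im}R_{mj}$, $R^i_\beta=g^{im}R_{m\beta}$. -/

import Mathlib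

open scoped Manifold ContDiff

noncomputable section

/-! ## The first order jet space and its d-tensors -/

section Jets

variable (p n : ℕ)
  (T : Type*) [TopologicalSpace T] [ChartedSpace (EuclideanSpace ℝ (Fin p)) T]
  (M : Type*) [TopologicalSpace M] [ChartedSpace (EuclideanSpace ℝ (Fin n)) M]

/-- The jet space `J¹(T, M)`: a point is a point `t` of `T`, a point `x` of `M` and a linear map
`T_t T → T_x M`, the differential at `t` of a map sending `t` to `x`. -/
structure JetSpace where
  time : T
  pos : M
  vel : TangentSpace (𝓡 p) time →L[ℝ] TangentSpace (𝓡 n) pos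

variable {p n T M}

/-- The space `T_t T ⊕ T_x M ⊕ Hom (T_t T, T_x M)` to which a nonlinear connection identifies the
tangent space of `J¹(T, M)` at a jet: `δ/δt^α`, `δ/δx^i`, `∂/∂x^i_α` correspond to `∂/∂t^α`,
`∂/∂x^i`, `dt^α ⊗ ∂/∂x^i`. Distinguished tensors (d-tensors) are tensors on these spaces. -/
abbrev JetSpace.Dist (e : JetSpace p n T M) : Type :=
  TangentSpace (𝓡 p) e.time × TangentSpace (𝓡 n) e.pos ×
    (TangentSpace (𝓡 p) e.time →L[ℝ] TangentSpace (𝓡 n) e.pos)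

variable (p n) in
/-- Local coordinates `(t^α, x^i, x^i_α)` on the jet space; `w.2.2 i α` is `x^i_α`. -/
abbrev JetCoord : Type :=
  EuclideanSpace ℝ (Fin p) × EuclideanSpace ℝ (Fin n) × (Fin n → Fin p → ℝ)

/-- The coordinate vector `∂/∂x^i` of the chart `φ` at the point with coordinates `τ`. -/
def coordVec {d : ℕ} {N : Type*} [TopologicalSpace N] [ChartedSpace (EuclideanSpace ℝ (Fin d)) N]
    (φ : OpenPartialHomeomorph N (EuclideanSpace ℝ (Fin d))) (i : Fin d)
    (τ : EuclideanSpace ℝ (Fin d)) : TangentSpace (𝓡 d) (φ.symm τ) :=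
  mfderiv (𝓡 d) (𝓡 d) φ.symm τ (EuclideanSpace.single i (1 : ℝ))

/-- The coordinate covector `dx^i` of the chart `φ` at the point with coordinates `τ`. -/
def coordCovec {d : ℕ} {N : Type*} [TopologicalSpace N]
    [ChartedSpace (EuclideanSpace ℝ (Fin d)) N]
    (φ : OpenPartialHomeomorph N (EuclideanSpace ℝ (Fin d))) (i : Fin d)
    (τ : EuclideanSpace ℝ (Fin d)) : TangentSpace (𝓡 d) (φ.symm τ) →L[ℝ] ℝ :=
  (EuclideanSpace.proj i : EuclideanSpace ℝ (Fin d) →L[ℝ] ℝ).comp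
    (mfderiv (𝓡 d) (𝓡 d) φ (φ.symm τ) :
      TangentSpace (𝓡 d) (φ.symm τ) →L[ℝ] EuclideanSpace ℝ (Fin d))

/-- The jet with coordinates `w` with respect to the charts `φ` of `T` and `ψ` of `M`. -/
def jetOfCoord (φ : OpenPartialHomeomorph T (EuclideanSpace ℝ (Fin p)))
    (ψ : OpenPartialHomeomorph M (EuclideanSpace ℝ (Fin n))) (w : JetCoord p n) :
    JetSpace p n T M where
  time := φ.symm w.1
  pos := ψ.symm w.2.1
  vel := ∑ i, ∑ α, w.2.2 i α • (coordCovec φ α w.1).smulRight (coordVec ψ i w.2.1)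

/-- The set of coordinates of all jets over the domains of the charts `φ` and `ψ`. -/
def coordDomain (φ : OpenPartialHomeomorph T (EuclideanSpace ℝ (Fin p)))
    (ψ : OpenPartialHomeomorph M (EuclideanSpace ℝ (Fin n))) : Set (JetCoord p n) :=
  {w | w.1 ∈ φ.target ∧ w.2.1 ∈ ψ.target}

variable (p n) in
/-- The indices `A ∈ {α, i, (i)(α)}` of the adapted basis. -/
abbrev FrameIdx : Type := Fin p ⊕ Fin n ⊕ (Fin n × Fin p)

/-- The adapted basis at a jet, in the identification `JetSpace.Dist`. -/
def distBasis (φ : OpenPartialHomeomorph T (EuclideanSpace ℝ (Fin p)))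
    (ψ : OpenPartialHomeomorph M (EuclideanSpace ℝ (Fin n))) (w : JetCoord p n) :
    FrameIdx p n → (jetOfCoord φ ψ w).Dist
  | .inl α => (coordVec φ α w.1, 0, 0)
  | .inr (.inl i) => (0, coordVec ψ i w.2.1, 0)
  | .inr (.inr (i, α)) => (0, 0, (coordCovec φ α w.1).smulRight (coordVec ψ i w.2.1))

variable (p n T M) in
/-- A d-tensor of type `(0, 2)` on the jet space. -/
abbrev DTensor02 : Type _ := ∀ e : JetSpace p n T M, e.Dist →ₗ[ℝ] e.Dist →ₗ[ℝ] ℝ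

/-- The adapted components of a d-tensor of type `(0, 2)`. -/
def DTensor02.comp (τ : DTensor02 p n T M)
    (φ : OpenPartialHomeomorph T (EuclideanSpace ℝ (Fin p)))
    (ψ : OpenPartialHomeomorph M (EuclideanSpace ℝ (Fin n)))
    (A B : FrameIdx p n) (w : JetCoord p n) : ℝ :=
  τ (jetOfCoord φ ψ w) (distBasis φ ψ w A) (distBasis φ ψ w B)

end Jets

/-! ## Local geometry in adapted coordinates -/

section Partial

variable {p n : ℕ}

/-- `∂f/∂t^α` -/
def dT (α : Fin p) (f : JetCoord p n → ℝ) (w : JetCoord p n) : ℝ :=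
  fderiv ℝ f w (EuclideanSpace.single α (1 : ℝ), 0, 0)

/-- `∂f/∂x^i` -/
def dX (i : Fin n) (f : JetCoord p n → ℝ) (w : JetCoord p n) : ℝ :=
  fderiv ℝ f w (0, EuclideanSpace.single i (1 : ℝ), 0)

/-- `∂f/∂x^i_α` -/
def dV (i : Fin n) (α : Fin p) (f : JetCoord p n → ℝ) (w : JetCoord p n) : ℝ :=
  fderiv ℝ f w (0, 0, Pi.single i (Pi.single α (1 : ℝ)))

end Partial

/-- Coordinate expressions of a temporal metric `h_{αβ}(t)`, of a spatial d-tensor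
`g_{ij}(t, x, x_γ)` and of a Lagrangian function. -/
structure LocalExpr (p n : ℕ) where
  h : EuclideanSpace ℝ (Fin p) → Matrix (Fin p) (Fin p) ℝ
  g : JetCoord p n → Matrix (Fin n) (Fin n) ℝ
  L : JetCoord p n → ℝ

namespace LocalExpr

variable {p n : ℕ} (X : LocalExpr p n)

/-- The Christoffel symbols `H^γ_{αβ}` of the temporal metric. -/
def chrH (γ α β : Fin p) (t : EuclideanSpace ℝ (Fin p)) : ℝ :=
  ∑ η, (X.h t)⁻¹ γ η / 2 *
    (fderiv ℝ (fun s => X.h s η α) t (EuclideanSpace.single β (1 : ℝ))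
      + fderiv ℝ (fun s => X.h s η β) t (EuclideanSpace.single α (1 : ℝ))
      - fderiv ℝ (fun s => X.h s α β) t (EuclideanSpace.single η (1 : ℝ)))

/-- The generalized Christoffel symbols `Γ^i_{jk}` of the spatial d-tensor. -/
def chrG (i j k : Fin n) (w : JetCoord p n) : ℝ :=
  ∑ m, (X.g w)⁻¹ i m / 2 *
    (dX k (fun z => X.g z m j) w + dX j (fun z => X.g z m k) w - dX m (fun z => X.g z j k) w)

/-- The spray `𝒢^i` of the case `p = 1`; the argument `o` is the unique temporal index. -/
def spray (o : Fin p) (i : Fin n) (w : JetCoord p n) : ℝ :=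
  ∑ k, (X.g w)⁻¹ i k / 4 *
    (∑ j, dX j (dV k o X.L) w * w.2.2 j o
      - dX k X.L w
      + dT o (dV k o X.L) w
      + dV k o X.L w * X.chrH o o o w.1
      + 2 * (X.h w.1)⁻¹ o o * X.chrH o o o w.1 * ∑ l, X.g w k l * w.2.2 l o)

/-- The coefficients `U^{(α)}_{(i)}(t, x)` of the linear part of the Lagrangian: for `p ≥ 2`,
`L = h^{αβ} g_{ij} x^i_α x^j_β + U^{(α)}_{(i)} x^i_α + F` with `g`, `U`, `F` depending on `(t, x)`,
so that `U` is the vertical derivative of `L` at `x^i_α = 0`. -/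
def linU (i : Fin n) (α : Fin p) (w : JetCoord p n) : ℝ :=
  dV i α X.L (w.1, w.2.1, 0)

/-- `U^{(α)}_{(k)j} = ∂U^{(α)}_{(k)}/∂x^j - ∂U^{(α)}_{(j)}/∂x^k` -/
def curlU (k : Fin n) (α : Fin p) (j : Fin n) (w : JetCoord p n) : ℝ :=
  dX j (X.linU k α) w - dX k (X.linU j α) w

/-- The temporal components `M^{(i)}_{(α)β}` of the canonical nonlinear connection (for `p = 1`,
the sum has the single term `-H^1_{11} y^i`). -/
def nlM (i : Fin n) (α β : Fin p) (w : JetCoord p n) : ℝ :=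
  -∑ γ, X.chrH γ α β w.1 * w.2.2 i γ

/-- The spatial components `N^{(i)}_{(α)j}` of the canonical nonlinear connection. -/
def nlN (i : Fin n) (α : Fin p) (j : Fin n) (w : JetCoord p n) : ℝ :=
  if p = 1 then X.h w.1 α α * dV j α (X.spray α i) w
  else
    ∑ k, X.chrG i j k w * w.2.2 k α
      + ∑ k, (X.g w)⁻¹ i k / 2 * dT α (fun z => X.g z j k) w
      + ∑ k, ∑ β, (X.g w)⁻¹ i k / 4 * X.h w.1 α β * X.curlU k β j w

/-- The adapted basis `δ/δt^α`, `δ/δx^i`, `∂/∂x^i_α` of vector fields. -/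
def frame : FrameIdx p n → JetCoord p n → JetCoord p n
  | .inl α, w => (EuclideanSpace.single α (1 : ℝ), 0, fun j β => -X.nlM j β α w)
  | .inr (.inl i), w => (0, EuclideanSpace.single i (1 : ℝ), fun j β => -X.nlN j β i w)
  | .inr (.inr (i, α)), _ => (0, 0, Pi.single i (Pi.single α (1 : ℝ)))

/-- The dual basis `dt^α`, `dx^i`, `δx^i_α = dx^i_α + M^{(i)}_{(α)β} dt^β + N^{(i)}_{(α)j} dx^j`,
evaluated on a tangent vector `v` at `w`. -/
def coframe (w v : JetCoord p n) : FrameIdx p n → ℝ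
  | .inl α => v.1 α
  | .inr (.inl i) => v.2.1 i
  | .inr (.inr (i, α)) =>
      v.2.2 i α + ∑ β, X.nlM i α β w * v.1 β + ∑ j, X.nlN i α j w * v.2.1 j

/-- The derivative `X_C f` of a function along the adapted basis. -/
def D (C : FrameIdx p n) (f : JetCoord p n → ℝ) (w : JetCoord p n) : ℝ :=
  fderiv ℝ f w (X.frame C w)

/-- Coefficients of the Cartan connection on temporal indices: `H^γ_{αβ}` along `δ/δt^β`, zero
along the other directions. -/
def conT (γ α : Fin p) : FrameIdx p n → JetCoord p n → ℝ
  | .inl β, w => X.chrH γ α β w.1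
  | .inr _, _ => 0

/-- Coefficients of the Cartan connection on spatial indices: `G^k_{jγ}` along `δ/δt^γ`, `L^k_{ji}`
along `δ/δx^i`, `C^{k(γ)}_{j(i)}` along `∂/∂x^i_γ`. -/
def conM (k j : Fin n) : FrameIdx p n → JetCoord p n → ℝ
  | .inl γ, w => ∑ i, (X.g w)⁻¹ k i / 2 * X.D (.inl γ) (fun z => X.g z i j) w
  | .inr (.inl i), w => ∑ m, (X.g w)⁻¹ k m / 2 *
      (X.D (.inr (.inl i)) (fun z => X.g z m j) w
        + X.D (.inr (.inl j)) (fun z => X.g z m i) w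
        - X.D (.inr (.inl m)) (fun z => X.g z j i) w)
  | .inr (.inr (i, γ)), w => ∑ m, (X.g w)⁻¹ k m / 2 *
      (dV i γ (fun z => X.g z m j) w + dV j γ (fun z => X.g z m i) w
        - dV m γ (fun z => X.g z j i) w)

/-- Coefficients of the Cartan connection on vertical indices (`h`-normality): the component
of `∇_{X_C} ∂/∂x^i_α` along `∂/∂x^k_β` is `δ^α_β Γ^k_{iC} - δ^k_i Γ^α_{βC}`, with the spatial and
the temporal coefficients on the right-hand side. Arguments: `(k, β)`, then `(i, α)`. -/
def conV (a b : Fin n × Fin p) (C : FrameIdx p n) (w : JetCoord p n) : ℝ :=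
  (if b.2 = a.2 then X.conM a.1 b.1 C w else 0) - (if a.1 = b.1 then X.conT b.2 a.2 C w else 0)

/-- The Cartan canonical connection `CΓ` in the adapted basis:
`∇_{X_C} X_A = ∑ D, (con D A C) X_D`. -/
def con : FrameIdx p n → FrameIdx p n → FrameIdx p n → JetCoord p n → ℝ
  | .inl γ, .inl α => X.conT γ α
  | .inr (.inl k), .inr (.inl j) => X.conM k j
  | .inr (.inr a), .inr (.inr b) => X.conV a b
  | _, _ => fun _ _ => 0

/-- The structure functions: `[X_C, X_B] = ∑ E, (struc E C B) X_E`. -/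
def struc (E C B : FrameIdx p n) (w : JetCoord p n) : ℝ :=
  X.coframe w (VectorField.lieBracket ℝ (X.frame C) (X.frame B) w) E

/-- The components `R^D_{ABC}` of the curvature of the Cartan connection, that is, the
components in the adapted basis of
`R(X_C, X_B) X_A = ∇_{X_C} ∇_{X_B} X_A - ∇_{X_B} ∇_{X_C} X_A - ∇_{[X_C, X_B]} X_A`. -/
def curv (D' A B C : FrameIdx p n) (w : JetCoord p n) : ℝ :=
  X.D C (X.con D' A B) w - X.D B (X.con D' A C) w
    + ∑ E, (X.con E A B w * X.con D' E C w - X.con E A C w * X.con D' E B w)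
    - ∑ E, X.struc E C B w * X.con D' A E w

/-- The Ricci d-tensor `R_{AB} = R^D_{ABD}`. -/
def ric (A B : FrameIdx p n) (w : JetCoord p n) : ℝ := ∑ D', X.curv D' A B D' w

/-- The gravitational `h`-potential
`G = h_{αβ} dt^α ⊗ dt^β + g_{ij} dx^i ⊗ dx^j + h^{αβ} g_{ij} δx^i_α ⊗ δx^j_β`. -/
def metric (A B : FrameIdx p n) (w : JetCoord p n) : ℝ :=
  match A, B with
  | .inl α, .inl β => X.h w.1 α β
  | .inr (.inl i), .inr (.inl j) => X.g w i j
  | .inr (.inr (i, α)), .inr (.inr (j, β)) => (X.h w.1)⁻¹ α β * X.g w i j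
  | _, _ => 0

/-- The inverse `G^{AB}` of the gravitational `h`-potential. -/
def metricInv (A B : FrameIdx p n) (w : JetCoord p n) : ℝ :=
  match A, B with
  | .inl α, .inl β => (X.h w.1)⁻¹ α β
  | .inr (.inl i), .inr (.inl j) => (X.g w)⁻¹ i j
  | .inr (.inr (i, α)), .inr (.inr (j, β)) => X.h w.1 α β * (X.g w)⁻¹ i j
  | _, _ => 0

/-- The scalar curvature `Sc(CΓ) = G^{AB} R_{AB}`. -/
def scal (w : JetCoord p n) : ℝ := ∑ A, ∑ B, X.metricInv A B w * X.ric A B w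

/-- The local covariant derivative along `X_C` of a d-tensor `E^b_a`, where `Γ₁` and `Γ₂` are the
connection coefficients that belong to the upper and to the lower index: the component
`E^b_{a|C} = X_C E^b_a + E^d_a Γ₁^b_{dC} - E^b_d Γ₂^d_{aC}`. -/
def covD {I J : Type} [Fintype I] [Fintype J]
    (Γ₁ : I → I → FrameIdx p n → JetCoord p n → ℝ) (Γ₂ : J → J → FrameIdx p n → JetCoord p n → ℝ)
    (E : I → J → JetCoord p n → ℝ) (b : I) (a : J) (C : FrameIdx p n) (w : JetCoord p n) : ℝ :=
  X.D C (E b a) w + ∑ d, E d a w * Γ₁ b d C w - ∑ d, E b d w * Γ₂ d a C w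

/-- The divergence `τ^B_{A|B}` of `τ^B_A = G^{BD} τ_{DA}`. -/
def divergence (τ : FrameIdx p n → FrameIdx p n → JetCoord p n → ℝ)
    (A : FrameIdx p n) (w : JetCoord p n) : ℝ :=
  ∑ B, X.covD X.con X.con (fun B A z => ∑ D', X.metricInv B D' z * τ D' A z) B A B w

/-- `H = h^{αβ} H_{αβ}`, where `H_{αβ}` denotes the temporal components of the Ricci d-tensor. -/
def scalH (w : JetCoord p n) : ℝ := ∑ α, ∑ β, (X.h w.1)⁻¹ α β * X.ric (.inl α) (.inl β) w

/-- `R = g^{ij} R_{ij}` -/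
def scalR (w : JetCoord p n) : ℝ :=
  ∑ i, ∑ j, (X.g w)⁻¹ i j * X.ric (.inr (.inl i)) (.inr (.inl j)) w

/-- `S = h_{αβ} g^{ij} S^{(α)(β)}_{(i)(j)}`, where `S^{(α)(β)}_{(i)(j)}` denotes the vertical
components of the Ricci d-tensor. -/
def scalS (w : JetCoord p n) : ℝ :=
  ∑ i, ∑ j, ∑ α, ∑ β, X.h w.1 α β * (X.g w)⁻¹ i j *
    X.ric (.inr (.inr (i, α))) (.inr (.inr (j, β))) w

/-- `H^μ_β = h^{μγ} H_{γβ}` -/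
def upH (μ β : Fin p) (w : JetCoord p n) : ℝ :=
  ∑ γ, (X.h w.1)⁻¹ μ γ * X.ric (.inl γ) (.inl β) w

/-- `R^i_β = g^{im} R_{mβ}` -/
def upRT (i : Fin n) (β : Fin p) (w : JetCoord p n) : ℝ :=
  ∑ m, (X.g w)⁻¹ i m * X.ric (.inr (.inl m)) (.inl β) w

/-- `R^i_j = g^{im} R_{mj}` -/
def upR (i j : Fin n) (w : JetCoord p n) : ℝ :=
  ∑ m, (X.g w)⁻¹ i m * X.ric (.inr (.inl m)) (.inr (.inl j)) w

/-- `P^{i (β)}_{(j)} = g^{im} P^{(β)}_{m(j)}` -/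
def upPV (i : Fin n) (b : Fin n × Fin p) (w : JetCoord p n) : ℝ :=
  ∑ m, (X.g w)⁻¹ i m * X.ric (.inr (.inl m)) (.inr (.inr b)) w

/-- `P^{(i)}_{(α)β} = h_{αμ} g^{im} P^{(μ)}_{(m)β}` -/
def upVT (a : Fin n × Fin p) (β : Fin p) (w : JetCoord p n) : ℝ :=
  ∑ m, ∑ μ, X.h w.1 a.2 μ * (X.g w)⁻¹ a.1 m * X.ric (.inr (.inr (m, μ))) (.inl β) w

/-- `P^{(i)}_{(α)j} = h_{αμ} g^{im} P^{(μ)}_{(m)j}` -/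
def upVM (a : Fin n × Fin p) (j : Fin n) (w : JetCoord p n) : ℝ :=
  ∑ m, ∑ μ, X.h w.1 a.2 μ * (X.g w)⁻¹ a.1 m * X.ric (.inr (.inr (m, μ))) (.inr (.inl j)) w

/-- `S^{(i)(β)}_{(α)(j)} = h_{αμ} g^{im} S^{(μ)(β)}_{(m)(j)}` -/
def upS (a b : Fin n × Fin p) (w : JetCoord p n) : ℝ :=
  ∑ m, ∑ μ, X.h w.1 a.2 μ * (X.g w)⁻¹ a.1 m * X.ric (.inr (.inr (m, μ))) (.inr (.inr b)) w

/-- The conservation formulas for `p = 1` at `w`; `o` is the unique temporal index, written `1`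
in the displayed formulas. -/
structure ConservationFormulasOne (o : Fin p) (w : JetCoord p n) : Prop where
  /-- `[(R+S)/2]_{/1} = R^m_{1|m} + P^{(m)}_{(1)1}|^{(1)}_{(m)}` -/
  time : X.D (.inl o) (fun z => (X.scalR z + X.scalS z) / 2) w
    = ∑ m, X.covD X.conM X.conT X.upRT m o (.inr (.inl m)) w
      + ∑ m, X.covD X.conV X.conT X.upVT (m, o) o (.inr (.inr (m, o))) w
  /-- `[R^m_j - (R+S)/2 δ^m_j]_{|m} = -P^{(m)}_{(1)j}|^{(1)}_{(m)}` -/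
  space : ∀ j : Fin n,
    ∑ m, X.covD X.conM X.conM
      (fun m j z => X.upR m j z - (X.scalR z + X.scalS z) / 2 * (if m = j then 1 else 0))
      m j (.inr (.inl m)) w
    = -∑ m, X.covD X.conV X.conM X.upVM (m, o) j (.inr (.inr (m, o))) w
  /-- `[S^{(m)(1)}_{(1)(j)} - (R+S)/2 δ^m_j]|^{(1)}_{(m)} = -P^{m(1)}_{(j)|m}` -/
  vert : ∀ j : Fin n,
    ∑ m, X.covD X.conV X.conV
      (fun a b z => X.upS a b z - (X.scalR z + X.scalS z) / 2 * (if a = b then 1 else 0))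
      (m, o) (j, o) (.inr (.inr (m, o))) w
    = -∑ m, X.covD X.conM X.conV X.upPV m (j, o) (.inr (.inl m)) w

/-- The conservation formulas for `p ≥ 2` at `w`. -/
structure ConservationFormulasMany (w : JetCoord p n) : Prop where
  /-- `[H^μ_β - (H+R)/2 δ^μ_β]_{/μ} = -R^m_{β|m}` -/
  time : ∀ β : Fin p,
    ∑ μ, X.covD X.conT X.conT
      (fun μ β z => X.upH μ β z - (X.scalH z + X.scalR z) / 2 * (if μ = β then 1 else 0))
      μ β (.inl μ) w
    = -∑ m, X.covD X.conM X.conT X.upRT m β (.inr (.inl m)) w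
  /-- `[R^m_j - (H+R)/2 δ^m_j]_{|m} = 0` -/
  space : ∀ j : Fin n,
    ∑ m, X.covD X.conM X.conM
      (fun m j z => X.upR m j z - (X.scalH z + X.scalR z) / 2 * (if m = j then 1 else 0))
      m j (.inr (.inl m)) w = 0

end LocalExpr

/-! ## Metrical multi-time Lagrange spaces -/

section Spaces

/-- A semi-Riemannian metric: a smooth field of symmetric nondegenerate bilinear forms of constant
signature (forms at any two points are isometric). -/
structure SemiRiemannianMetric (p : ℕ) (T : Type*) [TopologicalSpace T]
    [ChartedSpace (EuclideanSpace ℝ (Fin p)) T] where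
  form : ∀ t : T, TangentSpace (𝓡 p) t →ₗ[ℝ] TangentSpace (𝓡 p) t →ₗ[ℝ] ℝ
  symm : ∀ t u v, form t u v = form t v u
  nondegenerate : ∀ t u, (∀ v, form t u v = 0) → u = 0
  constantSignature : ∀ s t, ∃ e : TangentSpace (𝓡 p) s ≃ₗ[ℝ] TangentSpace (𝓡 p) t,
    ∀ u v, form t (e u) (e v) = form s u v
  smooth : ∀ φ ∈ IsManifold.maximalAtlas (𝓡 p) ∞ T, ∀ α β,
    ContDiffOn ℝ ∞ (fun τ => form (φ.symm τ) (coordVec φ α τ) (coordVec φ β τ)) φ.target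

/-- A metrical multi-time Lagrange space `ML^n_p = (J¹(T, M), L)`: a smooth Lagrangian function `L`
whose vertical fundamental metrical d-tensor is, in all adapted coordinates,
`(1/2) ∂²L/∂x^i_α ∂x^j_β = h^{αβ}(t) g_{ij}(t, x, x_γ)`, where `h` is a semi-Riemannian metric on
`T`, and `g` is a smooth symmetric d-tensor of rank `n` and of constant signature. -/
structure MultiTimeLagrangeSpace (p n : ℕ)
    (T : Type*) [TopologicalSpace T] [ChartedSpace (EuclideanSpace ℝ (Fin p)) T]
    (M : Type*) [TopologicalSpace M] [ChartedSpace (EuclideanSpace ℝ (Fin n)) M] where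
  h : SemiRiemannianMetric p T
  L : JetSpace p n T M → ℝ
  g : ∀ e : JetSpace p n T M, TangentSpace (𝓡 n) e.pos →ₗ[ℝ] TangentSpace (𝓡 n) e.pos →ₗ[ℝ] ℝ
  g_symm : ∀ e u v, g e u v = g e v u
  g_nondegenerate : ∀ e u, (∀ v, g e u v = 0) → u = 0
  g_constantSignature : ∀ e e', ∃ A : TangentSpace (𝓡 n) e.pos ≃ₗ[ℝ] TangentSpace (𝓡 n) e'.pos,
    ∀ u v, g e' (A u) (A v) = g e u v
  L_smooth : ∀ φ ∈ IsManifold.maximalAtlas (𝓡 p) ∞ T, ∀ ψ ∈ IsManifold.maximalAtlas (𝓡 n) ∞ M,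
    ContDiffOn ℝ ∞ (fun w => L (jetOfCoord φ ψ w)) (coordDomain φ ψ)
  g_smooth : ∀ φ ∈ IsManifold.maximalAtlas (𝓡 p) ∞ T, ∀ ψ ∈ IsManifold.maximalAtlas (𝓡 n) ∞ M,
    ∀ i j, ContDiffOn ℝ ∞
      (fun w => g (jetOfCoord φ ψ w) (coordVec ψ i w.2.1) (coordVec ψ j w.2.1)) (coordDomain φ ψ)
  kronecker : ∀ φ ∈ IsManifold.maximalAtlas (𝓡 p) ∞ T,
    ∀ ψ ∈ IsManifold.maximalAtlas (𝓡 n) ∞ M, ∀ w ∈ coordDomain φ ψ, ∀ i j α β,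
    1 / 2 * dV i α (dV j β fun z => L (jetOfCoord φ ψ z)) w
      = (Matrix.of fun μ ν => h.form (φ.symm w.1) (coordVec φ μ w.1) (coordVec φ ν w.1))⁻¹ α β
        * g (jetOfCoord φ ψ w) (coordVec ψ i w.2.1) (coordVec ψ j w.2.1)

namespace MultiTimeLagrangeSpace

variable {p n : ℕ}
  {T : Type*} [TopologicalSpace T] [ChartedSpace (EuclideanSpace ℝ (Fin p)) T]
  {M : Type*} [TopologicalSpace M] [ChartedSpace (EuclideanSpace ℝ (Fin n)) M]
  (S : MultiTimeLagrangeSpace p n T M)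

/-- The coordinate expressions of `h`, `g` and `L` in charts `φ` of `T` and `ψ` of `M`. -/
def loc (φ : OpenPartialHomeomorph T (EuclideanSpace ℝ (Fin p)))
    (ψ : OpenPartialHomeomorph M (EuclideanSpace ℝ (Fin n))) : LocalExpr p n where
  h t := Matrix.of fun μ ν => S.h.form (φ.symm t) (coordVec φ μ t) (coordVec φ ν t)
  g w := Matrix.of fun i j =>
    S.g (jetOfCoord φ ψ w) (coordVec ψ i w.2.1) (coordVec ψ j w.2.1)
  L w := S.L (jetOfCoord φ ψ w)

/-- The Einstein equations `Ric(CΓ) - (Sc(CΓ)/2) G = K 𝒯` in all adapted coordinates. -/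
def EinsteinEquations (K : ℝ) (𝒯 : DTensor02 p n T M) : Prop :=
  ∀ φ ∈ IsManifold.maximalAtlas (𝓡 p) ∞ T, ∀ ψ ∈ IsManifold.maximalAtlas (𝓡 n) ∞ M,
    ∀ w ∈ coordDomain φ ψ, ∀ A B,
      (S.loc φ ψ).ric A B w - (S.loc φ ψ).scal w / 2 * (S.loc φ ψ).metric A B w
        = K * 𝒯.comp φ ψ A B w

/-- The conservation laws `𝒯^B_{A|B} = 0` for all `A ∈ {α, i, (i)(α)}`, at the jet with
coordinates `w`. -/
def ConservationLaws (𝒯 : DTensor02 p n T M)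
    (φ : OpenPartialHomeomorph T (EuclideanSpace ℝ (Fin p)))
    (ψ : OpenPartialHomeomorph M (EuclideanSpace ℝ (Fin n))) (w : JetCoord p n) : Prop :=
  ∀ A, (S.loc φ ψ).divergence (𝒯.comp φ ψ) A w = 0

end MultiTimeLagrangeSpace

end Spaces

end

/-! Raising the first index in the Einstein equations gives K 𝒯^B_A = E^B_A with E^B_A = R^B_A -
(Sc/2) δ^B_A, so K times the divergence of 𝒯 is the divergence of E (`mul_divergence`). The Cartan
connection preserves the temporal, spatial and vertical blocks, so each component of the divergence
of E is a sum of one divergence per block. It remains to see which Ricci blocks vanish.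

For every p, the temporal coefficients are Christoffel symbols of h, which depend on t alone and
occur only along δ/δt^β; hence R_{αi} and R_{α(i)} vanish (`ric_time_nontemporal`). For p = 1 the
temporal block vanishes too, by antisymmetry of the curvature, so Sc = R + S and the laws are the
stated formulas.

For p ≥ 2 the decisive fact is that g depends only on (t, x) (`vertInvariantOn_g`): h^{αβ}
∂g_{ij}/∂x^k_γ is half a third vertical derivative of L, hence invariant under (i, α) ↔ (k, γ), and
contraction with h forces it to vanish. Then the connection has no coefficients along vertical
directions, and its other coefficients depend only on (t, x). All Ricci components with a vertical
index vanish and Sc = H + R. The vertical law becomes ∂Sc/∂x^i_α = 0, which holds automatically. -/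

open Filter Topology

noncomputable section

/-! ### Derivatives along the adapted basis and covariant derivatives. -/

namespace LocalExpr

variable {p n : ℕ} (X : LocalExpr p n)

/-- The `fderiv` of a function vanishes along every line on which the function is constant. -/
theorem fderiv_eq_zero_of_const_on_line {f : JetCoord p n → ℝ} {w u : JetCoord p n}
    (h : ∀ s : ℝ, f (w + s • u) = f w) : fderiv ℝ f w u = 0 := by
  -- If `f` is not differentiable at `w`, its `fderiv` is zero by convention.
  by_cases hd : DifferentiableAt ℝ f w
  · rw [← hd.lineDeriv_eq_fderiv, lineDeriv]
    simp [h]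
  · simp [fderiv_zero_of_not_differentiableAt hd]

theorem D_congr {f f' : JetCoord p n → ℝ} {w : JetCoord p n} (h : f =ᶠ[𝓝 w] f')
    (C : FrameIdx p n) : X.D C f w = X.D C f' w := by
  simp only [D, h.fderiv_eq]

/-- A scalar is zero or invertible, so no differentiability of `f` is needed. This lets `K` pass
through the divergence of a tensor of unknown regularity. -/
theorem D_const_mul (c : ℝ) (f : JetCoord p n → ℝ) (C : FrameIdx p n) (w : JetCoord p n) :
    X.D C (fun z => c * f z) w = c * X.D C f w := by
  have h : fderiv ℝ (fun z => c * f z) w = c • fderiv ℝ f w :=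
    congrFun (fderiv_const_smul_field (f := f) c) w
  simp [D, h]

theorem D_const (c : ℝ) (C : FrameIdx p n) (w : JetCoord p n) : X.D C (fun _ => c) w = 0 := by
  simp [D]

section CovariantDerivative

variable {I J : Type} [Fintype I] [Fintype J]
  (Γ₁ : I → I → FrameIdx p n → JetCoord p n → ℝ) (Γ₂ : J → J → FrameIdx p n → JetCoord p n → ℝ)

theorem covD_congr {E E' : I → J → JetCoord p n → ℝ} {w : JetCoord p n}
    (h : ∀ b a, E b a =ᶠ[𝓝 w] E' b a) (b : I) (a : J) (C : FrameIdx p n) :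
    X.covD Γ₁ Γ₂ E b a C w = X.covD Γ₁ Γ₂ E' b a C w := by
  have hw : ∀ b a, E b a w = E' b a w := fun b a => (h b a).self_of_nhds
  simp only [covD, X.D_congr (h b a), hw]

theorem covD_const_mul (c : ℝ) (E : I → J → JetCoord p n → ℝ) (b : I) (a : J)
    (C : FrameIdx p n) (w : JetCoord p n) :
    X.covD Γ₁ Γ₂ (fun b a z => c * E b a z) b a C w = c * X.covD Γ₁ Γ₂ E b a C w := by
  simp only [covD, X.D_const_mul, mul_sub, mul_add, Finset.mul_sum, mul_assoc]

theorem covD_eq_zero {E : I → J → JetCoord p n → ℝ} {w : JetCoord p n}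
    (h : ∀ b a, E b a =ᶠ[𝓝 w] fun _ => 0) (b : I) (a : J) (C : FrameIdx p n) :
    X.covD Γ₁ Γ₂ E b a C w = 0 := by
  rw [X.covD_congr Γ₁ Γ₂ h]
  simp [covD, D_const]

/-- The Kronecker delta is parallel. -/
theorem covD_mul_delta [DecidableEq I] (f : JetCoord p n → ℝ) (b a : I) (C : FrameIdx p n)
    (w : JetCoord p n) :
    X.covD Γ₁ Γ₁ (fun b a z => f z * (if b = a then 1 else 0)) b a C w
      = X.D C f w * (if b = a then 1 else 0) := by
  have h : X.D C (fun z => f z * (if b = a then 1 else 0)) w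
      = X.D C f w * (if b = a then 1 else 0) := by
    split_ifs <;> simp [D_const]
  rw [covD, h]
  -- The two connection terms are both f Γ^b_{aC}, with opposite signs.
  simp [mul_comm]

end CovariantDerivative

/-! ### The divergence, block by block. -/

/-- The divergence `E^B_{A|B}` of a tensor with mixed components. -/
def mixedDiv (E : FrameIdx p n → FrameIdx p n → JetCoord p n → ℝ) (A : FrameIdx p n)
    (w : JetCoord p n) : ℝ :=
  ∑ B, X.covD X.con X.con E B A B w

/-- The connection is block diagonal, so in each correction term the summation index stays in the
block of the index it replaces. The same reason gives the spatial and vertical versions. -/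
theorem mixedDiv_time (E : FrameIdx p n → FrameIdx p n → JetCoord p n → ℝ) (α : Fin p)
    (w : JetCoord p n) :
    X.mixedDiv E (.inl α) w
      = ∑ μ, X.covD X.conT X.conT (fun μ β => E (.inl μ) (.inl β)) μ α (.inl μ) w
        + ∑ m, X.covD X.conM X.conT (fun m β => E (.inr (.inl m)) (.inl β)) m α (.inr (.inl m)) w
        + ∑ a, X.covD X.conV X.conT (fun a β => E (.inr (.inr a)) (.inl β)) a α
            (.inr (.inr a)) w := by
  simp only [mixedDiv, covD, Fintype.sum_sum_type, con, mul_zero, Finset.sum_const_zero, add_zero,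
    zero_add, add_assoc]

theorem mixedDiv_space (E : FrameIdx p n → FrameIdx p n → JetCoord p n → ℝ) (j : Fin n)
    (w : JetCoord p n) :
    X.mixedDiv E (.inr (.inl j)) w
      = ∑ μ, X.covD X.conT X.conM (fun μ j => E (.inl μ) (.inr (.inl j))) μ j (.inl μ) w
        + ∑ m, X.covD X.conM X.conM (fun m j => E (.inr (.inl m)) (.inr (.inl j))) m j
            (.inr (.inl m)) w
        + ∑ a, X.covD X.conV X.conM (fun a j => E (.inr (.inr a)) (.inr (.inl j))) a j
            (.inr (.inr a)) w := by
  simp only [mixedDiv, covD, Fintype.sum_sum_type, con, mul_zero, Finset.sum_const_zero, add_zero,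
    zero_add, add_assoc]

theorem mixedDiv_vert (E : FrameIdx p n → FrameIdx p n → JetCoord p n → ℝ) (b : Fin n × Fin p)
    (w : JetCoord p n) :
    X.mixedDiv E (.inr (.inr b)) w
      = ∑ μ, X.covD X.conT X.conV (fun μ b => E (.inl μ) (.inr (.inr b))) μ b (.inl μ) w
        + ∑ m, X.covD X.conM X.conV (fun m b => E (.inr (.inl m)) (.inr (.inr b))) m b
            (.inr (.inl m)) w
        + ∑ a, X.covD X.conV X.conV (fun a b => E (.inr (.inr a)) (.inr (.inr b))) a b
            (.inr (.inr a)) w := by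
  simp only [mixedDiv, covD, Fintype.sum_sum_type, con, mul_zero, Finset.sum_const_zero, add_zero,
    zero_add, add_assoc]

/-! ### Raising an index, and the scalar curvature. -/

/-- The Ricci tensor with its first index raised, `R^B_A = G^{BD} R_{DA}`. -/
def ricUp (B A : FrameIdx p n) (w : JetCoord p n) : ℝ :=
  ∑ D', X.metricInv B D' w * X.ric D' A w

theorem metricInv_mul_metric {w : JetCoord p n} (hh : IsUnit (X.h w.1).det)
    (hg : IsUnit (X.g w).det) (B A : FrameIdx p n) :
    ∑ D', X.metricInv B D' w * X.metric D' A w = if B = A then 1 else 0 := by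
  have h1 : ∀ μ α, ∑ x, (X.h w.1)⁻¹ μ x * X.h w.1 x α = if μ = α then 1 else 0 := by
    intro μ α
    rw [← Matrix.mul_apply, Matrix.nonsing_inv_mul _ hh, Matrix.one_apply]
  have h2 : ∀ μ α, ∑ x, X.h w.1 μ x * (X.h w.1)⁻¹ x α = if μ = α then 1 else 0 := by
    intro μ α
    rw [← Matrix.mul_apply, Matrix.mul_nonsing_inv _ hh, Matrix.one_apply]
  have h3 : ∀ μ α, ∑ x, (X.g w)⁻¹ μ x * X.g w x α = if μ = α then 1 else 0 := by
    intro μ α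
    rw [← Matrix.mul_apply, Matrix.nonsing_inv_mul _ hg, Matrix.one_apply]
  rcases B with μ | i | ⟨i, μ⟩ <;> rcases A with α | j | ⟨j, α⟩ <;>
    simp [metricInv, metric, Fintype.sum_sum_type, h1, h3]
  -- The vertical block remains: the double sum factors into h h⁻¹ times g⁻¹ g.
  rw [Fintype.sum_prod_type]
  simp_rw [mul_mul_mul_comm, mul_comm (X.h w.1 μ _ * _), ← Finset.mul_sum, h2, ← Finset.sum_mul, h3]
  by_cases h : i = j <;> by_cases h' : μ = α <;> simp [h, h']

/-- The Einstein tensor with its first index raised. -/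
theorem raise_einstein {w : JetCoord p n} (hh : IsUnit (X.h w.1).det)
    (hg : IsUnit (X.g w).det) (B A : FrameIdx p n) :
    ∑ D', X.metricInv B D' w * (X.ric D' A w - X.scal w / 2 * X.metric D' A w)
      = X.ricUp B A w - X.scal w / 2 * (if B = A then 1 else 0) := by
  rw [← X.metricInv_mul_metric hh hg, ricUp, Finset.mul_sum, ← Finset.sum_sub_distrib]
  exact Finset.sum_congr rfl fun _ _ => by ring

theorem ricUp_time (μ : Fin p) (A : FrameIdx p n) (w : JetCoord p n) :
    X.ricUp (.inl μ) A w = ∑ γ, (X.h w.1)⁻¹ μ γ * X.ric (.inl γ) A w := by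
  simp [ricUp, metricInv, Fintype.sum_sum_type]

theorem ricUp_space (i : Fin n) (A : FrameIdx p n) (w : JetCoord p n) :
    X.ricUp (.inr (.inl i)) A w = ∑ m, (X.g w)⁻¹ i m * X.ric (.inr (.inl m)) A w := by
  simp [ricUp, metricInv, Fintype.sum_sum_type]

theorem ricUp_vert (a : Fin n × Fin p) (A : FrameIdx p n) (w : JetCoord p n) :
    X.ricUp (.inr (.inr a)) A w
      = ∑ m, ∑ μ, X.h w.1 a.2 μ * (X.g w)⁻¹ a.1 m * X.ric (.inr (.inr (m, μ))) A w := by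
  simp [ricUp, metricInv, Fintype.sum_sum_type, Fintype.sum_prod_type]

theorem scal_eq (w : JetCoord p n) : X.scal w = X.scalH w + X.scalR w + X.scalS w := by
  simp only [scal, scalH, scalR, scalS, metricInv, Fintype.sum_sum_type, zero_mul,
    Finset.sum_const_zero, add_zero, zero_add, Fintype.sum_prod_type, add_assoc]
  congr 2
  exact Finset.sum_congr rfl fun _ _ => Finset.sum_comm

/-! ### Brackets of the adapted basis. -/

/-- The Lie brackets of the adapted basis have no temporal components. -/
theorem struc_time (α : Fin p) (C B : FrameIdx p n) (w : JetCoord p n) :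
    X.struc (.inl α) C B w = 0 := by
  -- The temporal component of each basis field is constant, so its derivative vanishes.
  have key : ∀ B v, (fderiv ℝ (X.frame B) w v).1 = 0 := by
    intro B v
    by_cases hd : DifferentiableAt ℝ (X.frame B) w
    · have h := hd.hasFDerivAt.fst
      have hc : (fun z => (X.frame B z).1) = fun _ => (X.frame B w).1 := by
        rcases B with _ | _ | _ <;> rfl
      rw [hc] at h
      simpa using congrArg (fun l => l v) (h.unique (hasFDerivAt_const _ _))
    · simp [fderiv_zero_of_not_differentiableAt hd]
  simp [struc, coframe, VectorField.lieBracket, key]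

/-- The Lie brackets of the adapted basis have no spatial components. -/
theorem struc_space (i : Fin n) (C B : FrameIdx p n) (w : JetCoord p n) :
    X.struc (.inr (.inl i)) C B w = 0 := by
  have key : ∀ B v, (fderiv ℝ (X.frame B) w v).2.1 = 0 := by
    intro B v
    by_cases hd : DifferentiableAt ℝ (X.frame B) w
    · have h := hd.hasFDerivAt.snd.fst
      have hc : (fun z => (X.frame B z).2.1) = fun _ => (X.frame B w).2.1 := by
        rcases B with _ | _ | _ <;> rfl
      rw [hc] at h
      simpa using congrArg (fun l => l v) (h.unique (hasFDerivAt_const _ _))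
    · simp [fderiv_zero_of_not_differentiableAt hd]
  simp [struc, coframe, VectorField.lieBracket, key]

/-! ### Functions of (t, x) alone. -/

/-- `f` does not depend on the vertical coordinates over the coordinate domain `U`. -/
def VertInvariantOn (U : Set (JetCoord p n)) (f : JetCoord p n → ℝ) : Prop :=
  ∀ w ∈ U, ∀ v, f (w + (0, 0, v)) = f w

namespace VertInvariantOn

variable {U : Set (JetCoord p n)} {f : JetCoord p n → ℝ}

/-- Near `w` the function agrees with its vertical translate, and `fderiv` depends only on the germ.
-/
theorem fderiv_add (hU : IsOpen U) (hf : VertInvariantOn U f) {w : JetCoord p n} (hw : w ∈ U)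
    (v : Fin n → Fin p → ℝ) : fderiv ℝ f (w + (0, 0, v)) = fderiv ℝ f w := by
  rw [← fderiv_comp_add_right]
  refine Filter.EventuallyEq.fderiv_eq ?_
  filter_upwards [hU.mem_nhds hw] with z hz using hf z hz v

theorem fderiv_vert (hf : VertInvariantOn U f) {w : JetCoord p n} (hw : w ∈ U)
    (v : Fin n → Fin p → ℝ) : fderiv ℝ f w (0, 0, v) = 0 :=
  fderiv_eq_zero_of_const_on_line fun s => by simpa using hf w hw (s • v)

theorem D_vert (hf : VertInvariantOn U f) {w : JetCoord p n} (hw : w ∈ U) (a : Fin n × Fin p) :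
    X.D (.inr (.inr a)) f w = 0 :=
  hf.fderiv_vert hw _

theorem D_time (hf : VertInvariantOn U f) {w : JetCoord p n} (hw : w ∈ U) (α : Fin p) :
    X.D (.inl α) f w = dT α f w := by
  have h : X.frame (.inl α) w
      = (EuclideanSpace.single α (1 : ℝ), 0, 0) + (0, 0, fun j β => -X.nlM j β α w) := by
    simp [frame]
  rw [D, h, map_add, hf.fderiv_vert hw, add_zero, dT]

theorem D_space (hf : VertInvariantOn U f) {w : JetCoord p n} (hw : w ∈ U) (i : Fin n) :
    X.D (.inr (.inl i)) f w = dX i f w := by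
  have h : X.frame (.inr (.inl i)) w
      = (0, EuclideanSpace.single i (1 : ℝ), 0) + (0, 0, fun j β => -X.nlN j β i w) := by
    simp [frame]
  rw [D, h, map_add, hf.fderiv_vert hw, add_zero, dX]

/-- The adapted basis varies with the vertical coordinates through M and N, but only in its vertical
part, which annihilates `f`. -/
theorem vertInvariantOn_D (hU : IsOpen U) (hUv : ∀ w ∈ U, ∀ v, w + (0, 0, v) ∈ U)
    (hf : VertInvariantOn U f) (C : FrameIdx p n) :
    VertInvariantOn U (X.D C f) := by
  intro w hw v
  have hw' := hUv w hw v
  rcases C with α | i | a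
  · rw [hf.D_time X hw, hf.D_time X hw', dT, dT, hf.fderiv_add hU hw]
  · rw [hf.D_space X hw, hf.D_space X hw', dX, dX, hf.fderiv_add hU hw]
  · rw [hf.D_vert X hw, hf.D_vert X hw']

end VertInvariantOn

/-! ### Curvature and Ricci components for arbitrary p. -/

theorem D_conT_of_nontemporal (γ α β : Fin p) (b : Fin n ⊕ Fin n × Fin p) (w : JetCoord p n) :
    X.D (.inr b) (X.conT γ α (.inl β)) w = 0 := by
  refine fderiv_eq_zero_of_const_on_line fun s => ?_
  rcases b with b | b <;> simp [conT, frame]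

/-- Brackets have no temporal component, while `conT` vanishes along every other direction. -/
theorem sum_struc_mul_conT (γ α : Fin p) (C B : FrameIdx p n) (w : JetCoord p n) :
    ∑ E, X.struc E C B w * X.conT γ α E w = 0 := by
  simp [Fintype.sum_sum_type, struc_time, conT]

theorem curv_time (γ α : Fin p) (B C : FrameIdx p n) (w : JetCoord p n) :
    X.curv (.inl γ) (.inl α) B C w
      = X.D C (X.conT γ α B) w - X.D B (X.conT γ α C) w
        + ∑ η, (X.conT η α B w * X.conT γ η C w - X.conT η α C w * X.conT γ η B w) := by
  have h := X.sum_struc_mul_conT γ α C B w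
  simp only [curv, con, h, sub_zero]
  simp [Fintype.sum_sum_type (α₁ := Fin p)]

/-- The curvature vanishes between blocks of the adapted basis of different type. -/
theorem curv_of_ne_block {D' A : FrameIdx p n}
    (h : D'.map (fun _ => ()) (Sum.map (fun _ => ()) fun _ => ())
      ≠ A.map (fun _ => ()) (Sum.map (fun _ => ()) fun _ => ())) (B C : FrameIdx p n)
    (w : JetCoord p n) : X.curv D' A B C w = 0 := by
  have h0 : ∀ C, X.con D' A C = fun _ => 0 := by
    intro C
    rcases D' with _ | _ | _ <;> rcases A with _ | _ | _ <;> first | rfl | exact absurd rfl h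
  -- The intermediate index `E` cannot share a block with both `A` and `D'`.
  have h1 : ∀ E C C', X.con E A C w * X.con D' E C' w = 0 := by
    intro E C C'
    rcases D' with _ | _ | _ <;> rcases A with _ | _ | _ <;> rcases E with _ | _ | _ <;>
      first | exact absurd rfl h | exact zero_mul _ | exact mul_zero _
  simp [curv, h0, h1, D_const]

theorem ric_time (α : Fin p) (B : FrameIdx p n) (w : JetCoord p n) :
    X.ric (.inl α) B w = ∑ γ : Fin p, X.curv (.inl γ) (.inl α) B (.inl γ) w := by
  rw [ric, Fintype.sum_sum_type, add_eq_left]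
  exact Finset.sum_eq_zero fun b _ => X.curv_of_ne_block (by rcases b with _ | _ <;> simp) _ _ _

theorem ric_vert (a : Fin n × Fin p) (B : FrameIdx p n) (w : JetCoord p n) :
    X.ric (.inr (.inr a)) B w
      = ∑ b : Fin n × Fin p, X.curv (.inr (.inr b)) (.inr (.inr a)) B (.inr (.inr b)) w := by
  rw [ric, Fintype.sum_sum_type, Fintype.sum_sum_type, ← add_assoc, add_eq_right,
    Finset.sum_eq_zero, Finset.sum_eq_zero, add_zero]
  · exact fun b _ => X.curv_of_ne_block (by simp) _ _ _
  · exact fun b _ => X.curv_of_ne_block (by simp) _ _ _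

/-- In `curv_time`, every term contains either a temporal coefficient along a nontemporal direction,
or the derivative of a function of t in such a direction. -/
theorem ric_time_nontemporal (α : Fin p) (b : Fin n ⊕ Fin n × Fin p) (w : JetCoord p n) :
    X.ric (.inl α) (.inr b) w = 0 := by
  rw [ric_time]
  refine Finset.sum_eq_zero fun γ _ => ?_
  have h : X.conT (n := n) γ α (.inr b) = fun _ => 0 := rfl
  rw [curv_time, D_conT_of_nontemporal, h, D_const]
  simp [conT]

/-- With a single temporal direction, the last two curvature indices coincide, and the curvature is
antisymmetric in them. -/
theorem ric_time_time_of_subsingleton [Subsingleton (Fin p)] (α β : Fin p) (w : JetCoord p n) :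
    X.ric (.inl α) (.inl β) w = 0 := by
  rw [ric_time]
  refine Finset.sum_eq_zero fun γ _ => ?_
  rw [curv_time, Subsingleton.elim γ β]
  simp

/-! ### Curvature when g depends only on (t, x). -/

section VertInvariant

variable {X} {U : Set (JetCoord p n)} (hU : IsOpen U) (hUv : ∀ w ∈ U, ∀ v, w + (0, 0, v) ∈ U)
  (hg : ∀ i j, VertInvariantOn U fun z => X.g z i j)

include hg in
theorem vertInvariantOn_inv_g (i j : Fin n) : VertInvariantOn U fun z => (X.g z)⁻¹ i j := by
  intro w hw v
  have h : X.g (w + (0, 0, v)) = X.g w := Matrix.ext fun i j => hg i j w hw v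
  simp only [h]

include hg in
theorem conM_vert (k j : Fin n) (a : Fin n × Fin p) {w : JetCoord p n} (hw : w ∈ U) :
    X.conM k j (.inr (.inr a)) w = 0 := by
  have h : ∀ i γ k l, dV i γ (fun z => X.g z k l) w = 0 := fun i γ k l => (hg k l).fderiv_vert hw _
  simp [conM, h]

include hg in
theorem con_vert (D' A : FrameIdx p n) (a : Fin n × Fin p) {w : JetCoord p n} (hw : w ∈ U) :
    X.con D' A (.inr (.inr a)) w = 0 := by
  rcases D' with _ | _ | _ <;> rcases A with _ | _ | _ <;>
    simp [con, conT, conV, conM_vert hg _ _ _ hw]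

include hU hUv hg in
theorem vertInvariantOn_conM (k j : Fin n) (C : FrameIdx p n) :
    VertInvariantOn U (X.conM k j C) := by
  intro w hw v
  have h1 := fun i j => vertInvariantOn_inv_g hg i j w hw v
  have h2 := fun i j C => (hg i j).vertInvariantOn_D X hU hUv C w hw v
  rcases C with γ | i | a
  · simp only [conM, h1, h2]
  · simp only [conM, h1, h2]
  · rw [conM_vert hg _ _ _ hw, conM_vert hg _ _ _ (hUv w hw v)]

theorem vertInvariantOn_conT (γ α : Fin p) (C : FrameIdx p n) :
    VertInvariantOn U (X.conT γ α C) := by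
  intro w hw v
  rcases C with _ | _ <;> simp [conT]

include hU hUv hg in
theorem vertInvariantOn_con (D' A C : FrameIdx p n) : VertInvariantOn U (X.con D' A C) := by
  intro w hw v
  rcases D' with _ | _ | _ <;> rcases A with _ | _ | _ <;>
    simp only [con, conV, vertInvariantOn_conT _ _ _ w hw v,
      vertInvariantOn_conM hU hUv hg _ _ _ w hw v]

include hg in
-- Brackets of the adapted basis are vertical and the connection coefficients along vertical
-- directions vanish, so the bracket term drops out, and with it the nonlinear connection.
theorem curv_eq_of_mem (D' A B C : FrameIdx p n) {w : JetCoord p n} (hw : w ∈ U) :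
    X.curv D' A B C w = X.D C (X.con D' A B) w - X.D B (X.con D' A C) w
      + ∑ E, (X.con E A B w * X.con D' E C w - X.con E A C w * X.con D' E B w) := by
  have h : ∑ E, X.struc E C B w * X.con D' A E w = 0 := by
    refine Finset.sum_eq_zero fun E _ => ?_
    rcases E with _ | _ | _
    · simp [struc_time]
    · simp [struc_space]
    · simp [con_vert hg _ _ _ hw]
  rw [curv, h, sub_zero]

include hU hUv hg in
-- Every term contains a vertical derivative of a coefficient, or a coefficient along a vertical
-- direction, which vanishes on a whole neighbourhood.
theorem curv_vert_right (D' A B : FrameIdx p n) (a : Fin n × Fin p) {w : JetCoord p n}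
    (hw : w ∈ U) : X.curv D' A B (.inr (.inr a)) w = 0 := by
  have h : X.con D' A (.inr (.inr a)) =ᶠ[𝓝 w] fun _ => 0 := by
    filter_upwards [hU.mem_nhds hw] with z hz using con_vert hg _ _ _ hz
  rw [curv_eq_of_mem hg _ _ _ _ hw, (vertInvariantOn_con hU hUv hg _ _ _).D_vert X hw,
    X.D_congr h, D_const]
  simp [con_vert hg _ _ _ hw]

include hU hUv hg in
theorem curv_vert_left (D' A C : FrameIdx p n) (a : Fin n × Fin p) {w : JetCoord p n}
    (hw : w ∈ U) : X.curv D' A (.inr (.inr a)) C w = 0 := by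
  have h : X.con D' A (.inr (.inr a)) =ᶠ[𝓝 w] fun _ => 0 := by
    filter_upwards [hU.mem_nhds hw] with z hz using con_vert hg _ _ _ hz
  rw [curv_eq_of_mem hg _ _ _ _ hw, (vertInvariantOn_con hU hUv hg _ _ _).D_vert X hw,
    X.D_congr h, D_const]
  simp [con_vert hg _ _ _ hw]

include hU hUv hg in
theorem ric_vert_left_eq_zero (a : Fin n × Fin p) (B : FrameIdx p n) {w : JetCoord p n}
    (hw : w ∈ U) : X.ric (.inr (.inr a)) B w = 0 := by
  rw [ric_vert]
  exact Finset.sum_eq_zero fun b _ => curv_vert_right hU hUv hg _ _ _ _ hw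

include hU hUv hg in
theorem ric_vert_right_eq_zero (A : FrameIdx p n) (b : Fin n × Fin p) {w : JetCoord p n}
    (hw : w ∈ U) : X.ric A (.inr (.inr b)) w = 0 :=
  Finset.sum_eq_zero fun _ _ => curv_vert_left hU hUv hg _ _ _ _ hw

include hU hUv hg in
theorem vertInvariantOn_ric (A B : FrameIdx p n) : VertInvariantOn U (X.ric A B) := by
  intro w hw v
  have hw' := hUv w hw v
  have h1 := fun D' A C => vertInvariantOn_con hU hUv hg D' A C w hw v
  have h2 := fun D' A B C =>
    (vertInvariantOn_con hU hUv hg D' A B).vertInvariantOn_D X hU hUv C w hw v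
  simp only [ric, curv_eq_of_mem hg _ _ _ _ hw, curv_eq_of_mem hg _ _ _ _ hw', h1, h2]

include hU hUv hg in
theorem scalS_eq_zero {w : JetCoord p n} (hw : w ∈ U) : X.scalS w = 0 := by
  simp [scalS, ric_vert_left_eq_zero hU hUv hg _ _ hw]

include hU hUv hg in
-- This is what makes the vertical conservation law automatic for p ≥ 2.
theorem vertInvariantOn_scal : VertInvariantOn U X.scal := by
  intro w hw v
  have h1 := fun A B => vertInvariantOn_ric hU hUv hg A B w hw v
  have h2 := fun i j => vertInvariantOn_inv_g hg i j w hw v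
  rw [scal_eq, scal_eq, scalS_eq_zero hU hUv hg hw, scalS_eq_zero hU hUv hg (hUv w hw v)]
  simp [scalH, scalR, h1, h2]

end VertInvariant

end LocalExpr

/-! ### Invertibility of the metric matrices in charts. -/

section Charts

/-- The Gram matrix of a nondegenerate symmetric bilinear form in a basis is invertible. -/
theorem isUnit_det_gram {d : ℕ} {V : Type*} [AddCommGroup V] [Module ℝ V]
    (B : V →ₗ[ℝ] V →ₗ[ℝ] ℝ) (hs : ∀ u v, B u v = B v u) (hn : ∀ u, (∀ v, B u v = 0) → u = 0)
    (A : EuclideanSpace ℝ (Fin d) →ₗ[ℝ] V) (hA : Function.Bijective A) :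
    IsUnit (Matrix.of fun i j => B (A (EuclideanSpace.single i (1 : ℝ)))
      (A (EuclideanSpace.single j (1 : ℝ)))).det := by
  rw [isUnit_iff_ne_zero]
  intro h0
  -- A kernel vector of the Gram matrix gives a vector orthogonal to the range of `A`, which is all
  -- of `V`; nondegeneracy makes it zero and injectivity of `A` gives a contradiction.
  obtain ⟨v, hv, hv0⟩ := Matrix.exists_mulVec_eq_zero_iff.mpr h0
  have hexp : ∀ u : EuclideanSpace ℝ (Fin d),
      u = ∑ i, u i • EuclideanSpace.single i (1 : ℝ) := by
    intro u
    ext j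
    simp [Pi.single_apply]
  have hu : A (WithLp.toLp 2 v) = 0 := by
    refine hn _ fun x => ?_
    obtain ⟨y, rfl⟩ := hA.2 x
    rw [hs, hexp y, hexp (WithLp.toLp 2 v)]
    simp only [map_sum, map_smul, LinearMap.sum_apply, LinearMap.smul_apply, smul_eq_mul]
    simp only [Finset.mul_sum]
    rw [Finset.sum_comm]
    refine Finset.sum_eq_zero fun i _ => ?_
    have := congrFun hv0 i
    simp only [Matrix.mulVec, dotProduct, Matrix.of_apply, Pi.zero_apply] at this
    rw [← mul_zero (y i), ← this, Finset.mul_sum]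
    exact Finset.sum_congr rfl fun _ _ => by ring
  have h1 : WithLp.toLp 2 v = (0 : EuclideanSpace ℝ (Fin d)) := hA.1 (by rw [hu, map_zero])
  exact hv (by simpa using h1)

theorem mfderiv_symm_bijective {d : ℕ} {N : Type*} [TopologicalSpace N]
    [ChartedSpace (EuclideanSpace ℝ (Fin d)) N] [IsManifold (𝓡 d) ∞ N]
    {φ : OpenPartialHomeomorph N (EuclideanSpace ℝ (Fin d))}
    (hφ : φ ∈ IsManifold.maximalAtlas (𝓡 d) ∞ N) {τ : EuclideanSpace ℝ (Fin d)}
    (hτ : τ ∈ φ.target) :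
    Function.Bijective (mfderiv (𝓡 d) (𝓡 d) φ.symm τ) := by
  have h : φ.MDifferentiable (𝓡 d) (𝓡 d) :=
    ⟨(contMDiffOn_of_mem_maximalAtlas hφ).mdifferentiableOn (by simp),
      (contMDiffOn_symm_of_mem_maximalAtlas hφ).mdifferentiableOn (by simp)⟩
  exact h.symm.mfderiv_bijective hτ

end Charts

/-! ### Vertical derivatives, and vertical independence of g for p ≥ 2. -/

section Domain

variable {p n : ℕ} {T : Type*} [TopologicalSpace T] {M : Type*} [TopologicalSpace M]

theorem isOpen_coordDomain (φ : OpenPartialHomeomorph T (EuclideanSpace ℝ (Fin p)))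
    (ψ : OpenPartialHomeomorph M (EuclideanSpace ℝ (Fin n))) : IsOpen (coordDomain φ ψ) :=
  (φ.open_target.preimage continuous_fst).inter
    (ψ.open_target.preimage (continuous_fst.comp continuous_snd))

theorem coordDomain_add_vert {φ : OpenPartialHomeomorph T (EuclideanSpace ℝ (Fin p))}
    {ψ : OpenPartialHomeomorph M (EuclideanSpace ℝ (Fin n))} {w : JetCoord p n}
    (hw : w ∈ coordDomain φ ψ) (v : Fin n → Fin p → ℝ) : w + (0, 0, v) ∈ coordDomain φ ψ := by
  simpa [coordDomain] using hw

end Domain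

section VerticalDerivative

variable {p n : ℕ} {U : Set (JetCoord p n)} {f : JetCoord p n → ℝ} {w : JetCoord p n}

theorem contDiffOn_dV (hU : IsOpen U) (hf : ContDiffOn ℝ ∞ f U) (i : Fin n) (α : Fin p) :
    ContDiffOn ℝ ∞ (dV i α f) U :=
  (hf.fderiv_of_isOpen hU (by simp)).clm_apply contDiffOn_const

/-- Vertical partial derivatives commute. -/
theorem dV_comm (hU : IsOpen U) (hf : ContDiffOn ℝ ∞ f U) (hw : w ∈ U) (i k : Fin n)
    (α γ : Fin p) : dV k γ (dV i α f) w = dV i α (dV k γ f) w := by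
  have hc : ContDiffAt ℝ ∞ f w := hf.contDiffAt (hU.mem_nhds hw)
  have hs : IsSymmSndFDerivAt ℝ f w := hc.isSymmSndFDerivAt
    (by simpa using WithTop.coe_le_coe.mpr (le_top : (2 : ℕ∞) ≤ ⊤))
  have hd : DifferentiableAt ℝ (fderiv ℝ f) w :=
    ((hf.fderiv_of_isOpen (m := ∞) hU (by simp)).contDiffAt (hU.mem_nhds hw)).differentiableAt
      (by simp)
  have h : ∀ u v, fderiv ℝ (fun z => fderiv ℝ f z u) w v = fderiv ℝ (fderiv ℝ f) w v u := by
    intro u v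
    rw [fderiv_clm_apply hd (differentiableAt_const _)]
    simp
  exact (h _ _).trans ((hs _ _).trans (h _ _).symm)

/-- A function with vanishing vertical partial derivatives does not depend on the vertical
coordinates. -/
theorem vertInvariantOn_of_dV_eq_zero (hf : ∀ w ∈ U, DifferentiableAt ℝ f w)
    (hUv : ∀ w ∈ U, ∀ v, w + (0, 0, v) ∈ U) (h : ∀ w ∈ U, ∀ i α, dV i α f w = 0) :
    LocalExpr.VertInvariantOn U f := by
  intro w hw v
  have hv : ∀ z ∈ U, fderiv ℝ f z (0, 0, v) = 0 := by
    intro z hz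
    have hsum : ((0, 0, v) : JetCoord p n)
        = ∑ i, ∑ α, v i α • (0, 0, Pi.single i (Pi.single α (1 : ℝ))) := by
      ext j
      · simp [Prod.fst_sum]
      · simp [Prod.fst_sum, Prod.snd_sum]
      · rename_i β
        simp [Prod.snd_sum, Finset.sum_apply, Pi.single_apply, ite_apply]
    rw [hsum]
    simp only [map_sum, map_smul]
    exact Finset.sum_eq_zero fun i _ => Finset.sum_eq_zero fun α _ => by
      rw [show fderiv ℝ f z (0, 0, Pi.single i (Pi.single α (1 : ℝ))) = 0 from h z hz i α, smul_zero]
  -- The whole line from `w` in the direction `v` lies in `U`, so `f` is constant along it.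
  have hderiv : ∀ s : ℝ, HasDerivAt (fun s : ℝ => f (w + s • (0, 0, v))) 0 s := by
    intro s
    have hz : w + s • ((0, 0, v) : JetCoord p n) ∈ U := by simpa using hUv w hw (s • v)
    have h1 : HasDerivAt (fun s : ℝ => w + s • ((0, 0, v) : JetCoord p n)) (0, 0, v) s := by
      simpa using ((hasDerivAt_id s).smul_const ((0, 0, v) : JetCoord p n)).const_add w
    have h2 := (hf _ hz).hasFDerivAt.comp_hasDerivAt s h1
    rwa [hv _ hz] at h2
  have := is_const_of_deriv_eq_zero (fun s => (hderiv s).differentiableAt)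
    (fun s => (hderiv s).deriv) 1 0
  simpa using this

/-- The factor is constant along vertical lines, so line derivatives suffice and `c` itself need not
be differentiable. -/
theorem dV_const_time_mul {c : EuclideanSpace ℝ (Fin p) → ℝ}
    (hcf : DifferentiableAt ℝ (fun z => c z.1 * f z) w) (hf : DifferentiableAt ℝ f w) (i : Fin n)
    (α : Fin p) : dV i α (fun z => c z.1 * f z) w = c w.1 * dV i α f w := by
  rw [dV, dV, ← hcf.lineDeriv_eq_fderiv, ← hf.lineDeriv_eq_fderiv, lineDeriv, lineDeriv]
  simp

end VerticalDerivative

/-- A tensor `A_{ijk}^γ` with `A_{ijk}^γ η^{αβ} = A_{kji}^α η^{γβ}` for an invertible `η` vanishes in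
dimension at least two. -/
theorem eq_zero_of_mul_swap {p : ℕ} {I : Type*} (hp : 2 ≤ p) {η : Matrix (Fin p) (Fin p) ℝ}
    (hη : IsUnit η.det) {A : I → I → I → Fin p → ℝ}
    (h : ∀ i j k α β γ, η α β * A i j k γ = η γ β * A k j i α) (i j k : I) (γ : Fin p) :
    A i j k γ = 0 := by
  -- Contraction with η⁻¹ over α and β: the left side yields p copies of A, the right side a single
  -- one.
  have key : ∀ i k, p * A i j k γ = A k j i γ := by
    intro i k
    have h1 : ∀ γ α, ∑ β, η γ β * η⁻¹ β α = if γ = α then 1 else 0 := by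
      intro γ α
      rw [← Matrix.mul_apply, Matrix.mul_nonsing_inv _ hη, Matrix.one_apply]
    have h2 : ∑ α, ∑ β, η⁻¹ β α * (η α β * A i j k γ) = ∑ α, ∑ β, η⁻¹ β α * (η γ β * A k j i α) := by
      simp only [h i j k]
    have h3 : ∀ α, ∑ β, η⁻¹ β α * (η α β * A i j k γ) = A i j k γ := by
      intro α
      have := h1 α α
      simp only [if_true] at this
      calc ∑ β, η⁻¹ β α * (η α β * A i j k γ) = (∑ β, η α β * η⁻¹ β α) * A i j k γ := by
            rw [Finset.sum_mul]
            exact Finset.sum_congr rfl fun _ _ => by ring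
        _ = A i j k γ := by rw [this, one_mul]
    have h4 : ∀ α, ∑ β, η⁻¹ β α * (η γ β * A k j i α) = if γ = α then A k j i α else 0 := by
      intro α
      calc ∑ β, η⁻¹ β α * (η γ β * A k j i α) = (∑ β, η γ β * η⁻¹ β α) * A k j i α := by
            rw [Finset.sum_mul]
            exact Finset.sum_congr rfl fun _ _ => by ring
        _ = if γ = α then A k j i α else 0 := by rw [h1, ite_mul, one_mul, zero_mul]
    simp only [h3, h4] at h2
    simpa using h2
  -- Two applications give p² A = A, and p² ≠ 1.
  have h5 := key i k
  have h6 := key k i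
  rw [← h5] at h6
  have hp' : (2 : ℝ) ≤ p := by exact_mod_cast hp
  have h7 : ((p : ℝ) * p - 1) * A i j k γ = 0 := by linarith
  rcases mul_eq_zero.mp h7 with h8 | h8
  · nlinarith
  · exact h8

namespace MultiTimeLagrangeSpace

variable {p n : ℕ}
  {T : Type*} [TopologicalSpace T] [ChartedSpace (EuclideanSpace ℝ (Fin p)) T]
  {M : Type*} [TopologicalSpace M] [ChartedSpace (EuclideanSpace ℝ (Fin n)) M]
  (S : MultiTimeLagrangeSpace p n T M)
  {φ : OpenPartialHomeomorph T (EuclideanSpace ℝ (Fin p))}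
  {ψ : OpenPartialHomeomorph M (EuclideanSpace ℝ (Fin n))} {w : JetCoord p n}

theorem isUnit_det_h [IsManifold (𝓡 p) ∞ T] (hφ : φ ∈ IsManifold.maximalAtlas (𝓡 p) ∞ T)
    (hw : w ∈ coordDomain φ ψ) : IsUnit ((S.loc φ ψ).h w.1).det :=
  isUnit_det_gram (S.h.form (φ.symm w.1)) (S.h.symm _) (S.h.nondegenerate _)
    (mfderiv (𝓡 p) (𝓡 p) φ.symm w.1).toLinearMap (mfderiv_symm_bijective hφ hw.1)

theorem isUnit_det_g [IsManifold (𝓡 n) ∞ M] (hψ : ψ ∈ IsManifold.maximalAtlas (𝓡 n) ∞ M)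
    (hw : w ∈ coordDomain φ ψ) : IsUnit ((S.loc φ ψ).g w).det :=
  isUnit_det_gram (S.g (jetOfCoord φ ψ w)) (S.g_symm _) (S.g_nondegenerate _)
    (mfderiv (𝓡 n) (𝓡 n) ψ.symm w.2.1).toLinearMap (mfderiv_symm_bijective hψ hw.2)

/-- For `p ≥ 2`, the spatial metrical d-tensor depends only on `(t, x)`. -/
theorem vertInvariantOn_g [IsManifold (𝓡 p) ∞ T] (hp : 2 ≤ p)
    (hφ : φ ∈ IsManifold.maximalAtlas (𝓡 p) ∞ T) (hψ : ψ ∈ IsManifold.maximalAtlas (𝓡 n) ∞ M)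
    (i j : Fin n) :
    LocalExpr.VertInvariantOn (coordDomain φ ψ) fun z => (S.loc φ ψ).g z i j := by
  set X := S.loc φ ψ with hX
  have hU := isOpen_coordDomain φ ψ
  have hL : ContDiffOn ℝ ∞ X.L (coordDomain φ ψ) := S.L_smooth φ hφ ψ hψ
  have hg : ∀ i j, ∀ w ∈ coordDomain φ ψ, DifferentiableAt ℝ (fun z => X.g z i j) w :=
    fun i j w hw => ((S.g_smooth φ hφ ψ hψ i j).contDiffAt (hU.mem_nhds hw)).differentiableAt
      (by simp)
  have hK : ∀ w ∈ coordDomain φ ψ, ∀ i j α β,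
      (X.h w.1)⁻¹ α β * X.g w i j = 1 / 2 * dV i α (dV j β X.L) w :=
    fun w hw i j α β => (S.kronecker φ hφ ψ hψ w hw i j α β).symm
  refine vertInvariantOn_of_dV_eq_zero (hg i j) (fun w hw v => coordDomain_add_vert hw v)
    fun w hw k γ => ?_
  -- The vertical derivative of the Kronecker condition; its right side is symmetric in the three
  -- pairs of indices.
  have hdd : ∀ i j k α β γ, (X.h w.1)⁻¹ α β * dV k γ (fun z => X.g z i j) w
      = 1 / 2 * dV k γ (dV i α (dV j β X.L)) w := by
    intro i j k α β γ
    have he : (fun z => (X.h z.1)⁻¹ α β * X.g z i j)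
        =ᶠ[𝓝 w] fun z => 1 / 2 * dV i α (dV j β X.L) z := by
      filter_upwards [hU.mem_nhds hw] with z hz using hK z hz i j α β
    have hd : DifferentiableAt ℝ (dV i α (dV j β X.L)) w :=
      ((contDiffOn_dV hU (contDiffOn_dV hU hL j β) i α).contDiffAt
        (hU.mem_nhds hw)).differentiableAt (by simp)
    -- The product is differentiable because it equals a derivative of L near `w`.
    have hd' := (hd.const_mul (1 / 2 : ℝ)).congr_of_eventuallyEq he
    rw [← dV_const_time_mul (c := fun t => (X.h t)⁻¹ α β) hd' (hg i j w hw), dV, he.fderiv_eq,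
      fderiv_const_mul hd]
    rfl
  have hη : IsUnit (X.h w.1)⁻¹.det := by
    rw [Matrix.det_nonsing_inv]
    exact (S.isUnit_det_h hφ hw).ringInverse
  refine eq_zero_of_mul_swap (A := fun i j k γ => dV k γ (fun z => X.g z i j) w) hp hη ?_ i j k γ
  intro i j k α β γ
  rw [hdd, hdd, dV_comm hU (contDiffOn_dV hU hL j β) hw]

end MultiTimeLagrangeSpace

/-! ### The divergence of the Einstein tensor and the conservation formulas. -/

namespace LocalExpr

variable {p n : ℕ} (X : LocalExpr p n)

/-- The Einstein tensor with its first index raised. -/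
def einUp (B A : FrameIdx p n) (w : JetCoord p n) : ℝ :=
  X.ricUp B A w - X.scal w / 2 * (if B = A then 1 else 0)

/-- If `K τ` is the Einstein tensor, then `K` times the divergence of `τ` is the divergence of the
Einstein tensor. -/
theorem mul_divergence {K : ℝ} {τ : FrameIdx p n → FrameIdx p n → JetCoord p n → ℝ}
    {w : JetCoord p n}
    (h : ∀ᶠ z in 𝓝 w, IsUnit (X.h z.1).det ∧ IsUnit (X.g z).det ∧
      ∀ A B, X.ric A B z - X.scal z / 2 * X.metric A B z = K * τ A B z)
    (A : FrameIdx p n) : K * X.divergence τ A w = X.mixedDiv X.einUp A w := by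
  rw [divergence, mixedDiv, Finset.mul_sum]
  refine Finset.sum_congr rfl fun B _ => ?_
  -- With `K` inside the derivative, the two tensors need only agree near `w`.
  rw [← covD_const_mul]
  refine X.covD_congr _ _ (fun B A => ?_) _ _ _
  filter_upwards [h] with z hz
  rw [einUp, ← X.raise_einstein hz.1 hz.2.1, Finset.mul_sum]
  exact Finset.sum_congr rfl fun D' _ => by rw [hz.2.2]; ring

theorem mixedDiv_einUp_iff_one (hp : p = 1) (o : Fin p) (w : JetCoord p n) :
    (∀ A, X.mixedDiv X.einUp A w = 0) ↔ X.ConservationFormulasOne o w := by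
  subst hp
  have ho : o = 0 := Subsingleton.elim _ _
  subst ho
  have hH : ∀ z, X.scalH z = 0 := fun z => by simp [scalH, ric_time_time_of_subsingleton]
  have hSc : ∀ z, X.scal z = X.scalR z + X.scalS z := fun z => by rw [scal_eq, hH, zero_add]
  -- Since H_{11} = 0, the temporal block is a multiple of the parallel Kronecker delta, so its
  -- divergence is a derivative of (R+S)/2.
  have e1 : (fun μ β => X.einUp (.inl μ) (.inl β))
      = fun μ β z => -1 * ((X.scalR z + X.scalS z) / 2 * (if μ = β then 1 else 0)) := by
    funext μ β z
    rw [neg_one_mul]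
    simp [einUp, ricUp_time, ric_time_time_of_subsingleton, hSc, -mul_ite]
  have e2 : (fun m β => X.einUp (.inr (.inl m)) (.inl β)) = X.upRT := by
    funext m β z
    simp [einUp, ricUp_space, upRT]
  have e3 : (fun a β => X.einUp (.inr (.inr a)) (.inl β)) = X.upVT := by
    funext a β z
    simp [einUp, ricUp_vert, upVT]
  have e4 : ∀ b, X.einUp (.inl (0 : Fin 1)) (.inr b) = fun _ => 0 := by
    intro b
    funext z
    simp [einUp, ricUp_time, ric_time_nontemporal]
  have e5 : (fun m j => X.einUp (.inr (.inl m)) (.inr (.inl j)))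
      = fun m j z => X.upR m j z - (X.scalR z + X.scalS z) / 2 * (if m = j then 1 else 0) := by
    funext m j z
    simp [einUp, ricUp_space, upR, hSc]
  have e6 : (fun a j => X.einUp (.inr (.inr a)) (.inr (.inl j))) = X.upVM := by
    funext a β z
    simp [einUp, ricUp_vert, upVM]
  have e7 : (fun m b => X.einUp (.inr (.inl m)) (.inr (.inr b))) = X.upPV := by
    funext m b z
    simp [einUp, ricUp_space, upPV]
  have e8 : (fun a b => X.einUp (.inr (.inr a)) (.inr (.inr b)))
      = fun a b z => X.upS a b z - (X.scalR z + X.scalS z) / 2 * (if a = b then 1 else 0) := by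
    funext a b z
    simp [einUp, ricUp_vert, upS, hSc]
  have t : X.mixedDiv X.einUp (.inl 0) w
      = -X.D (.inl 0) (fun z => (X.scalR z + X.scalS z) / 2) w
        + ∑ m, X.covD X.conM X.conT X.upRT m 0 (.inr (.inl m)) w
        + ∑ m, X.covD X.conV X.conT X.upVT (m, 0) 0 (.inr (.inr (m, 0))) w := by
    rw [mixedDiv_time, e1, e2, e3]
    simp only [covD_const_mul, covD_mul_delta, Fintype.sum_prod_type, Finset.univ_unique,
      Finset.sum_singleton, Fin.default_eq_zero, if_true]
    ring
  have s : ∀ j, X.mixedDiv X.einUp (.inr (.inl j)) w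
      = ∑ m, X.covD X.conM X.conM
          (fun m j z => X.upR m j z - (X.scalR z + X.scalS z) / 2 * (if m = j then 1 else 0))
          m j (.inr (.inl m)) w
        + ∑ m, X.covD X.conV X.conM X.upVM (m, 0) j (.inr (.inr (m, 0))) w := by
    intro j
    rw [mixedDiv_space, e5, e6, Finset.sum_eq_zero, zero_add, Fintype.sum_prod_type]
    · simp only [Finset.univ_unique, Finset.sum_singleton, Fin.default_eq_zero]
    · exact fun μ _ => X.covD_eq_zero _ _
        (fun μ j => by rw [Subsingleton.elim μ 0, e4]) _ _ _
  have v : ∀ j, X.mixedDiv X.einUp (.inr (.inr (j, 0))) w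
      = ∑ m, X.covD X.conM X.conV X.upPV m (j, 0) (.inr (.inl m)) w
        + ∑ m, X.covD X.conV X.conV
          (fun a b z => X.upS a b z - (X.scalR z + X.scalS z) / 2 * (if a = b then 1 else 0))
          (m, 0) (j, 0) (.inr (.inr (m, 0))) w := by
    intro j
    rw [mixedDiv_vert, e7, e8, Finset.sum_eq_zero, zero_add, Fintype.sum_prod_type]
    · simp only [Finset.univ_unique, Finset.sum_singleton, Fin.default_eq_zero]
    · exact fun μ _ => X.covD_eq_zero _ _
        (fun μ j => by rw [Subsingleton.elim μ 0, e4]) _ _ _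
  constructor
  · intro h
    refine ⟨?_, fun j => ?_, fun j => ?_⟩
    · linarith [h (.inl 0)]
    · linarith [h (.inr (.inl j)), s j]
    · linarith [h (.inr (.inr (j, 0))), v j]
  · intro h A
    rcases A with α | j | ⟨j, α⟩
    · rw [Subsingleton.elim α 0]
      linarith [h.time]
    · linarith [h.space j, s j]
    · rw [Subsingleton.elim α 0]
      linarith [h.vert j, v j]

theorem mixedDiv_einUp_iff_many {U : Set (JetCoord p n)} (hU : IsOpen U)
    (hUv : ∀ w ∈ U, ∀ v, w + (0, 0, v) ∈ U) (hg : ∀ i j, VertInvariantOn U fun z => X.g z i j)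
    {w : JetCoord p n} (hw : w ∈ U) :
    (∀ A, X.mixedDiv X.einUp A w = 0) ↔ X.ConservationFormulasMany w := by
  -- The vertical Ricci block vanishes only on `U`, hence the equalities of germs below.
  have hS : ∀ z ∈ U, X.scal z = X.scalH z + X.scalR z := fun z hz => by
    rw [scal_eq, scalS_eq_zero hU hUv hg hz, add_zero]
  have e1 : ∀ μ β, X.einUp (.inl μ) (.inl β)
      =ᶠ[𝓝 w] fun z => X.upH μ β z - (X.scalH z + X.scalR z) / 2 * (if μ = β then 1 else 0) := by
    intro μ β
    filter_upwards [hU.mem_nhds hw] with z hz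
    simp [einUp, ricUp_time, upH, hS z hz]
  have e2 : (fun m β => X.einUp (.inr (.inl m)) (.inl β)) = X.upRT := by
    funext m β z
    simp [einUp, ricUp_space, upRT]
  have e3 : ∀ a β, X.einUp (.inr (.inr a)) (.inl β) =ᶠ[𝓝 w] fun _ => 0 := by
    intro a β
    filter_upwards [hU.mem_nhds hw] with z hz
    simp [einUp, ricUp_vert, ric_vert_left_eq_zero hU hUv hg _ _ hz]
  have e4 : ∀ μ b, X.einUp (.inl μ) (.inr b) = fun _ => 0 := by
    intro μ b
    funext z
    simp [einUp, ricUp_time, ric_time_nontemporal]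
  have e5 : ∀ m j, X.einUp (.inr (.inl m)) (.inr (.inl j))
      =ᶠ[𝓝 w] fun z => X.upR m j z - (X.scalH z + X.scalR z) / 2 * (if m = j then 1 else 0) := by
    intro m j
    filter_upwards [hU.mem_nhds hw] with z hz
    simp [einUp, ricUp_space, upR, hS z hz]
  have e6 : ∀ a j, X.einUp (.inr (.inr a)) (.inr (.inl j)) =ᶠ[𝓝 w] fun _ => 0 := by
    intro a j
    filter_upwards [hU.mem_nhds hw] with z hz
    simp [einUp, ricUp_vert, ric_vert_left_eq_zero hU hUv hg _ _ hz]
  have e7 : ∀ m b, X.einUp (.inr (.inl m)) (.inr (.inr b)) =ᶠ[𝓝 w] fun _ => 0 := by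
    intro m b
    filter_upwards [hU.mem_nhds hw] with z hz
    simp [einUp, ricUp_space, ric_vert_right_eq_zero hU hUv hg _ _ hz]
  -- Only the trace part survives, so the vertical divergence is -1/2 times a vertical derivative of
  -- Sc.
  have e8 : ∀ a b, X.einUp (.inr (.inr a)) (.inr (.inr b))
      =ᶠ[𝓝 w] fun z => -1 / 2 * (X.scal z * (if a = b then 1 else 0)) := by
    intro a b
    filter_upwards [hU.mem_nhds hw] with z hz
    simp only [einUp, ricUp_vert, ric_vert_left_eq_zero hU hUv hg _ _ hz, Sum.inr.injEq,
      mul_zero, Finset.sum_const_zero]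
    ring
  have t : ∀ β, X.mixedDiv X.einUp (.inl β) w
      = ∑ μ, X.covD X.conT X.conT
          (fun μ β z => X.upH μ β z - (X.scalH z + X.scalR z) / 2 * (if μ = β then 1 else 0))
          μ β (.inl μ) w
        + ∑ m, X.covD X.conM X.conT X.upRT m β (.inr (.inl m)) w := by
    intro β
    simp only [mixedDiv_time, e2, X.covD_congr _ _ e1, X.covD_eq_zero _ _ e3,
      Finset.sum_const_zero, add_zero]
  have s : ∀ j, X.mixedDiv X.einUp (.inr (.inl j)) w
      = ∑ m, X.covD X.conM X.conM
          (fun m j z => X.upR m j z - (X.scalH z + X.scalR z) / 2 * (if m = j then 1 else 0))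
          m j (.inr (.inl m)) w := by
    intro j
    simp only [mixedDiv_space, e4, X.covD_congr _ _ e5, X.covD_eq_zero _ _ e6,
      X.covD_eq_zero _ _ fun _ _ => EventuallyEq.rfl, Finset.sum_const_zero, add_zero, zero_add]
  have v : ∀ b, X.mixedDiv X.einUp (.inr (.inr b)) w = 0 := by
    intro b
    simp only [mixedDiv_vert, e4, X.covD_congr _ _ e8, X.covD_eq_zero _ _ e7,
      X.covD_eq_zero _ _ fun _ _ => EventuallyEq.rfl, covD_const_mul, covD_mul_delta,
      (vertInvariantOn_scal hU hUv hg).D_vert X hw, zero_mul, mul_zero, Finset.sum_const_zero,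
      add_zero]
  constructor
  · intro h
    refine ⟨fun β => ?_, fun j => ?_⟩
    · linarith [h (.inl β), t β]
    · rw [← s j, h]
  · intro h A
    rcases A with β | j | b
    · linarith [h.time β, t β]
    · rw [s j, h.space j]
    · exact v b

end LocalExpr

end

theorem mainTheorem3 {p n : ℕ}
    {T : Type*} [TopologicalSpace T] [ChartedSpace (EuclideanSpace ℝ (Fin p)) T]
    [IsManifold (𝓡 p) ∞ T]
    {M : Type*} [TopologicalSpace M] [ChartedSpace (EuclideanSpace ℝ (Fin n)) M]
    [IsManifold (𝓡 n) ∞ M]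
    (S : MultiTimeLagrangeSpace p n T M) (K : ℝ) (𝒯 : DTensor02 p n T M)
    (hE : S.EinsteinEquations K 𝒯)
    (φ : OpenPartialHomeomorph T (EuclideanSpace ℝ (Fin p)))
    (hφ : φ ∈ IsManifold.maximalAtlas (𝓡 p) ∞ T)
    (ψ : OpenPartialHomeomorph M (EuclideanSpace ℝ (Fin n)))
    (hψ : ψ ∈ IsManifold.maximalAtlas (𝓡 n) ∞ M)
    (w : JetCoord p n) (hw : w ∈ coordDomain φ ψ) :
    (p = 1 → ∀ o : Fin p,
      (S.ConservationLaws 𝒯 φ ψ w → (S.loc φ ψ).ConservationFormulasOne o w) ∧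
      (K ≠ 0 → (S.loc φ ψ).ConservationFormulasOne o w → S.ConservationLaws 𝒯 φ ψ w)) ∧
    (2 ≤ p →
      (S.ConservationLaws 𝒯 φ ψ w → (S.loc φ ψ).ConservationFormulasMany w) ∧
      (K ≠ 0 → (S.loc φ ψ).ConservationFormulasMany w → S.ConservationLaws 𝒯 φ ψ w)) := by
  have hU := isOpen_coordDomain φ ψ
  have hK : ∀ A, K * (S.loc φ ψ).divergence (𝒯.comp φ ψ) A w
      = (S.loc φ ψ).mixedDiv (S.loc φ ψ).einUp A w := by
    refine (S.loc φ ψ).mul_divergence ?_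
    filter_upwards [hU.mem_nhds hw] with z hz
    exact ⟨S.isUnit_det_h hφ hz, S.isUnit_det_g hψ hz, hE φ hφ ψ hψ z hz⟩
  -- The forward implication multiplies by `K`, whatever its value; only the converse cancels it.
  have key : ∀ {P : Prop}, ((∀ A, (S.loc φ ψ).mixedDiv (S.loc φ ψ).einUp A w = 0) ↔ P) →
      (S.ConservationLaws 𝒯 φ ψ w → P) ∧ (K ≠ 0 → P → S.ConservationLaws 𝒯 φ ψ w) := by
    intro P hP
    refine ⟨fun h => hP.mp fun A => ?_, fun hK0 h A => ?_⟩
    · rw [← hK, h A, mul_zero]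
    · have := hP.mpr h A
      rw [← hK] at this
      exact (mul_eq_zero.mp this).resolve_left hK0
  exact ⟨fun hp o => key ((S.loc φ ψ).mixedDiv_einUp_iff_one hp o w),
    fun hp => key ((S.loc φ ψ).mixedDiv_einUp_iff_many hU
      (fun z hz v => coordDomain_add_vert hz v) (S.vertInvariantOn_g hp hφ hψ) hw)⟩
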